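/- **Theorem.** Let $A_0\ge 1$, $\delta\in(0,1)$ and $\tau_0>0$ with $144A_0^8\delta\le 1$. Then there are constants $C_2,\eta>0$, depending only on $A_0,\delta,\tau_0$, such that the following holds. Let $\rho$ be a quasi-metric on a set $X$, that is, $\rho$ satisfies the axioms of a metric with the triangle inequality weakened to $\rho(x,y)\le A_0(\rho(x,z)+\rho(z,y))$. Write $B(x,r)=\{y:\rho(y,x)<r\}$, and assume geometric doubling: for some $A_1\in\mathbb N$ every ball $B(x,r)$ is covered by at most $A_1$ balls of radius $r/2$. Call $U\subseteq X$ open if for every $x\in U$ there is $\varepsilon>0$ with $B(x,\varepsilon)\subseteq U$; interior, closure $\bar S$ and boundary $\partial S$ refer to this topology. Write $\tilde S$ for the interior of $S$, and $\rho(x,S)=\inf_{y\in S}\rho(x,y)$, with $\rho(x,\emptyset)=\infty$. Let $\{x^k_\alpha\}$, $k\in\mathbb Z$, $\alpha\in\mathcal A_k$, be reference points: $\rho(x^k_\alpha,x^k_\beta)\ge\delta^k$ for $\alpha\ne\beta$, and for all $x\in X$ and $k$ there is $\alpha$ with $\rho(x,x^k_\alpha)<\delta^k$. Let every $(k+1,\beta)$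 be assigned exactly one parent $(k,\alpha)$, written $(k+1,\beta)\le(k,\alpha)$, such that $\rho(x^{k+1}_\beta,x^k_\alpha)<(2A_0)^{-1}\delta^k$ implies $(k+1,\beta)\le(k,\alpha)$, and $(k+1,\beta)\le(k,\alpha)$ implies $\rho(x^{k+1}_\beta,x^k_\alpha)<\delta^k$. Let $(\Omega,\mathbb P)$ be a probability space with $\Omega=\prod_{k\in\mathbb Z}\Omega_k$ (with the product $\sigma$-algebra) whose coordinates $\omega_k\in\Omega_k$ are independent. Suppose that every $\omega\in\Omega$ defines points $z^k_\alpha(\omega)=z^k_\alpha(\omega_k)\in X$, depending on $\omega_k$ only, and sets (cubes) $Q^k_\alpha(\omega)\subseteq X$, $k\in\mathbb Z$, $\alpha\in\mathcal A_k$, such that, with $c_1=(12A_0^4)^{-1}$, $C_1=4A_0^2$ and $\omega$ suppressed, * if $\ell\ge k$, then $Q^\ell_\beta\subseteq Q^k_\alpha$ or $Q^k_\alpha\cap Q^\ell_\beta=\emptyset$; * for every $k$, $X$ is the disjoint union of the $Q^k_\alpha$, $\alpha\in\mathcal A_k$; * $B(z^k_\alpha,c_1\delta^k)\subseteq Q^k_\alpha\subseteq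 B(z^k_\alpha,C_1\delta^k)$; * if $k\le\ell$ and $Q^\ell_\beta\subseteq Q^k_\alpha$, then $B(z^\ell_\beta,C_1\delta^\ell)\subseteq B(z^k_\alpha,C_1\delta^k)$. Suppose also that, whenever $(k+1,\beta)\le(k,\alpha)$, the event $\{z^k_\alpha(\omega)=x^{k+1}_\beta\}$ is measurable and has probability at least $\tau_0$. For $\varepsilon>0$ let $\partial_\varepsilon Q=\{x\in\bar Q:\rho(x,X\setminus\tilde Q)\le\varepsilon\}$. Then: 1. for every $x\in X$, $\tau>0$ and $k\in\mathbb Z$, $$\mathbb P\Big(\Big\{\omega: x\in\bigcup_\alpha\partial_{\tau\delta^k}Q^k_\alpha(\omega)\Big\}\Big)\le C_2\tau^\eta;$$ 2. for every $x\in X$, $$\mathbb P\Big(\Big\{\omega: x\in\bigcup_{k,\alpha}\partial Q^k_\alpha(\omega)\Big\}\Big)=0;$$ 3. for every $\sigma$-finite measure $\mu$ on $X$, defined on a $\sigma$-algebra that contains the open sets, $$\mu\Big(\bigcup_{k,\alpha}\partial Q^k_\alpha(\omega)\Big)=0\quad\text{for a.e. }\omega\in\Omega.$$ Here $\mathbb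 P$ of a set not known to be measurable denotes its outer measure. -/

import Mathlib

open MeasureTheory ProbabilityTheory Set
open scoped ENNReal Topology

universe u v w

/-- `ρ` is a quasi-metric on `X` with quasi-triangle constant `A₀`. -/
structure IsQuasiMetric {X : Type u} (A₀ : ℝ) (ρ : X → X → ℝ) : Prop where
  nonneg : ∀ x y, 0 ≤ ρ x y
  eq_zero_iff : ∀ x y, ρ x y = 0 ↔ x = y
  symm : ∀ x y, ρ x y = ρ y x
  quasi_triangle : ∀ x y z, ρ x y ≤ A₀ * (ρ x z + ρ z y)

/-- The ball `B(x, r) = {y | ρ(y, x) < r}`. It need not be open. -/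
def qBall {X : Type u} (ρ : X → X → ℝ) (x : X) (r : ℝ) : Set X := {y | ρ y x < r}

/-- Geometric doubling: every ball of radius `r` is covered by at most `A₁` balls of
radius `r / 2`. -/
def IsGeometricallyDoubling {X : Type u} (ρ : X → X → ℝ) (A₁ : ℕ) : Prop :=
  ∀ (x : X) (r : ℝ), 0 < r →
    ∃ s : Finset X, s.card ≤ A₁ ∧ qBall ρ x r ⊆ ⋃ y ∈ s, qBall ρ y (r / 2)

/-- The topology of a quasi-metric: `U` is open if with every point it contains a ball centred
at that point. -/
abbrev qTopology {X : Type u} (ρ : X → X → ℝ) : TopologicalSpace X where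
  IsOpen U := ∀ x ∈ U, ∃ ε : ℝ, 0 < ε ∧ qBall ρ x ε ⊆ U
  isOpen_univ := fun _ _ => ⟨1, one_pos, subset_univ _⟩
  isOpen_inter := by
    rintro s t hs ht x ⟨hxs, hxt⟩
    obtain ⟨a, ha, has⟩ := hs x hxs
    obtain ⟨b, hb, hbt⟩ := ht x hxt
    exact ⟨min a b, lt_min ha hb, fun y hy =>
      ⟨has (lt_of_lt_of_le hy (min_le_left a b)), hbt (lt_of_lt_of_le hy (min_le_right a b))⟩⟩
  isOpen_sUnion := by
    rintro S hS x ⟨t, htS, hxt⟩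
    obtain ⟨a, ha, hat⟩ := hS t htS x hxt
    exact ⟨a, ha, fun y hy => ⟨t, htS, hat hy⟩⟩

/-- The interior of a set; for a half-open cube this is the open cube. -/
def qInterior {X : Type u} (ρ : X → X → ℝ) (S : Set X) : Set X := @interior X (qTopology ρ) S

/-- The closure of a set; for a half-open cube this is the closed cube. -/
def qClosure {X : Type u} (ρ : X → X → ℝ) (S : Set X) : Set X := @closure X (qTopology ρ) S

/-- The boundary `∂S`, closure minus interior. -/
def qBoundary {X : Type u} (ρ : X → X → ℝ) (S : Set X) : Set X := qClosure ρ S \ qInterior ρ S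

/-- The distance `ρ(x, S) = inf {ρ(x, y) | y ∈ S}`, equal to `∞` for `S = ∅`. -/
noncomputable def qSetDist {X : Type u} (ρ : X → X → ℝ) (x : X) (S : Set X) : ℝ≥0∞ :=
  ⨅ y ∈ S, ENNReal.ofReal (ρ x y)

/-- The `ε`-boundary zone of a cube `Q`: the points of the closed cube at distance at most `ε`
from the complement of the open cube. -/
def boundaryZone {X : Type u} (ρ : X → X → ℝ) (ε : ℝ) (Q : Set X) : Set X :=
  {x | x ∈ qClosure ρ Q ∧ qSetDist ρ x (qInterior ρ Q)ᶜ ≤ ENNReal.ofReal ε}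

/-- A family of reference points `x k α`, `k ∈ ℤ`, `α ∈ I k`, with parameter `δ`. -/
structure IsReferencePoints {X : Type u} {I : ℤ → Type v} (ρ : X → X → ℝ) (δ : ℝ)
    (x : ∀ k, I k → X) : Prop where
  separated : ∀ (k : ℤ) (α β : I k), α ≠ β → δ ^ k ≤ ρ (x k α) (x k β)
  covering : ∀ (k : ℤ) (y : X), ∃ α : I k, ρ y (x k α) < δ ^ k

/-- The partial order of reference points, given by its restriction to consecutive generations:
`(k + 1, β) ≤ (k, α)` means `parent k β = α`. Every index has exactly one parent; a point of
generation `k` at distance less than `(2 A₀)⁻¹ δ ^ k` is the parent; the parent is at distance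
less than `δ ^ k`. -/
structure IsParentMap {X : Type u} {I : ℤ → Type v} (A₀ : ℝ) (ρ : X → X → ℝ) (δ : ℝ)
    (x : ∀ k, I k → X) (parent : ∀ k, I (k + 1) → I k) : Prop where
  eq_of_near : ∀ (k : ℤ) (β : I (k + 1)) (α : I k),
    ρ (x (k + 1) β) (x k α) < (2 * A₀)⁻¹ * δ ^ k → parent k β = α
  dist_lt : ∀ (k : ℤ) (β : I (k + 1)), ρ (x (k + 1) β) (x k (parent k β)) < δ ^ k

/-- The family of (half-open) cubes `Q k α` is a dyadic system with centres `z k α`, relative to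
the parameters `c₀`, `C₀`. Open and closed cubes are the interiors and closures of the
half-open ones. The inner and outer radii are `c₁ δ ^ k` and `C₁ δ ^ k` with
`c₁ = (3 A₀ ^ 2)⁻¹ c₀` and `C₁ = 2 A₀ C₀`. -/
structure IsDyadicSystem {X : Type u} {I : ℤ → Type v} (A₀ c₀ C₀ : ℝ) (ρ : X → X → ℝ) (δ : ℝ)
    (z : ∀ k, I k → X) (Q : ∀ k, I k → Set X) : Prop where
  nested : ∀ (k l : ℤ), k ≤ l → ∀ (α : I k) (β : I l), Q l β ⊆ Q k α ∨ Q k α ∩ Q l β = ∅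
  cover : ∀ k : ℤ, ⋃ α, Q k α = univ
  disjoint : ∀ (k : ℤ) (α β : I k), α ≠ β → Disjoint (Q k α) (Q k β)
  ball_subset : ∀ (k : ℤ) (α : I k),
    qBall ρ (z k α) ((3 * A₀ ^ 2)⁻¹ * c₀ * δ ^ k) ⊆ Q k α
  subset_ball : ∀ (k : ℤ) (α : I k), Q k α ⊆ qBall ρ (z k α) (2 * A₀ * C₀ * δ ^ k)
  ball_mono : ∀ (k l : ℤ), k ≤ l → ∀ (α : I k) (β : I l), Q l β ⊆ Q k α →
    qBall ρ (z l β) (2 * A₀ * C₀ * δ ^ l) ⊆ qBall ρ (z k α) (2 * A₀ * C₀ * δ ^ k)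

/-- A random dyadic system over the probability space `(∏ k, Ω k, P)`, built on the reference
points `x` with parent map `parent`. The coordinates `ω k` are independent, the centre `z k α`
depends on the coordinate `ω k` only, the cube `Q k α` is a function of all of `ω`, and every
`ω` gives a dyadic system with parameters `c₀ = (4 A₀ ^ 2)⁻¹`, `C₀ = 2 A₀`. Whenever `(k + 1, β)`
is a child of `(k, α)`, the event that `z k α` equals `x (k + 1) β` is measurable and has
probability at least `τ₀`. -/
structure IsRandomDyadicSystem {X : Type u} {I : ℤ → Type v} {Ω : ℤ → Type w}
    [∀ k, MeasurableSpace (Ω k)] (A₀ : ℝ) (ρ : X → X → ℝ) (δ τ₀ : ℝ)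
    (x : ∀ k, I k → X) (parent : ∀ k, I (k + 1) → I k)
    (P : Measure (∀ k, Ω k)) (z : ∀ k, I k → Ω k → X)
    (Q : ∀ k, I k → (∀ j, Ω j) → Set X) : Prop where
  indep : iIndepFun (fun (k : ℤ) (ω : ∀ j, Ω j) => ω k) P
  dyadic : ∀ ω : ∀ j, Ω j, IsDyadicSystem A₀ (4 * A₀ ^ 2)⁻¹ (2 * A₀) ρ δ
    (fun k α => z k α (ω k)) (fun k α => Q k α ω)
  measurableSet_eq : ∀ (k : ℤ) (α : I k) (β : I (k + 1)), parent k β = α →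
    MeasurableSet {s : Ω k | z k α s = x (k + 1) β}
  le_prob : ∀ (k : ℤ) (α : I k) (β : I (k + 1)), parent k β = α →
    ENNReal.ofReal τ₀ ≤ P {ω | z k α (ω k) = x (k + 1) β}

/-! Fix a point `p`. In every generation `l + 1` some reference point lies within `δ ^ (l + 1)` of
`p`, and with probability at least `τ₀` it becomes the centre of its parent. Then `p` lies so deep
in the parent cube that the ball of radius `δ ^ (l + 1)` at `p` stays inside
(`exists_qBall_subset`), and by nestedness this keeps `p` off the thin boundary zones of all coarser
cubes (`notMem_centredPairs`). These events depend on different coordinates, so `n` consecutive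
failures have probability at most `(1 - τ₀) ^ n`. Taking `δ ^ n` comparable to `τ` gives the power
bound; `n → ∞` gives null boundaries; Fubini, applied to a measurable set containing the boundary
pairs, gives the statement for `μ`. -/

/-! ### Topology and doubling in quasi-metric spaces -/

section QuasiMetric

variable {X : Type u} {A₀ : ℝ} {ρ : X → X → ℝ}

lemma mem_qBall_self (hρ : IsQuasiMetric A₀ ρ) (p : X) {r : ℝ} (hr : 0 < r) :
    p ∈ qBall ρ p r := by
  simpa [qBall, (hρ.eq_zero_iff p p).2 rfl] using hr

lemma qBall_subset_qBall (hA : 1 ≤ A₀) (hρ : IsQuasiMetric A₀ ρ) {p q : X} {r s t : ℝ}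
    (hq : q ∈ qBall ρ p s) (h : A₀ * (r + s) ≤ t) : qBall ρ q r ⊆ qBall ρ p t := by
  intro y hy
  have h1 := hρ.quasi_triangle y p q
  have hy' : ρ y q < r := hy
  have hq' : ρ q p < s := hq
  have : A₀ * (ρ y q + ρ q p) < A₀ * (r + s) :=
    mul_lt_mul_of_pos_left (add_lt_add hy' hq') (by linarith)
  exact lt_of_le_of_lt h1 (this.trans_le h)

lemma isOpen_iff_qBall {U : Set X} :
    IsOpen[qTopology ρ] U ↔ ∀ x ∈ U, ∃ ε : ℝ, 0 < ε ∧ qBall ρ x ε ⊆ U := Iff.rfl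

lemma isOpen_qInterior (S : Set X) : IsOpen[qTopology ρ] (qInterior ρ S) :=
  @isOpen_interior X (qTopology ρ) S

lemma qInterior_subset (S : Set X) : qInterior ρ S ⊆ S :=
  @interior_subset X (qTopology ρ) S

/-- Balls need not be open, but the points having some ball inside `S` form an open set: two steps
of length `r / (2 * A₀)` stay within `r`. -/
lemma mem_qInterior_iff (hA : 1 ≤ A₀) (hρ : IsQuasiMetric A₀ ρ) {S : Set X} {p : X} :
    p ∈ qInterior ρ S ↔ ∃ ε : ℝ, 0 < ε ∧ qBall ρ p ε ⊆ S := by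
  constructor
  · intro hp
    obtain ⟨ε, hε, h⟩ := isOpen_iff_qBall.1 (isOpen_qInterior S) p hp
    exact ⟨ε, hε, h.trans (qInterior_subset S)⟩
  · rintro ⟨ε, hε, h⟩
    have hopen : IsOpen[qTopology ρ] {y | ∃ ε : ℝ, 0 < ε ∧ qBall ρ y ε ⊆ S} := by
      rw [isOpen_iff_qBall]
      rintro y ⟨r, hr, hy⟩
      have hr' : 0 < r / (2 * A₀) := by positivity
      refine ⟨r / (2 * A₀), hr', fun w hw => ⟨r / (2 * A₀), hr', ?_⟩⟩
      refine (qBall_subset_qBall hA hρ hw (le_of_eq ?_)).trans hy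
      field_simp
      ring
    have hsub : {y | ∃ ε : ℝ, 0 < ε ∧ qBall ρ y ε ⊆ S} ⊆ S := by
      rintro y ⟨r, hr, hy⟩
      exact hy (mem_qBall_self hρ y hr)
    exact (@mem_interior X (qTopology ρ) p S).2 ⟨_, hsub, hopen, ε, hε, h⟩

lemma qBall_subset_qInterior_qBall (hA : 1 ≤ A₀) (hρ : IsQuasiMetric A₀ ρ) (p : X) {r : ℝ}
    (hr : 0 < r) : qBall ρ p r ⊆ qInterior ρ (qBall ρ p (2 * A₀ * r)) := by
  intro y hy
  refine (mem_qInterior_iff hA hρ).2 ⟨r, hr, qBall_subset_qBall hA hρ hy (le_of_eq ?_)⟩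
  ring

lemma notMem_qClosure_of_disjoint (hA : 1 ≤ A₀) (hρ : IsQuasiMetric A₀ ρ) {S T : Set X} {p : X}
    {r : ℝ} (hr : 0 < r) (hS : qBall ρ p r ⊆ S) (hST : Disjoint S T) : p ∉ qClosure ρ T := by
  have h : p ∈ qInterior ρ Tᶜ :=
    (mem_qInterior_iff hA hρ).2 ⟨r, hr, hS.trans hST.subset_compl_right⟩
  have h2 : qInterior ρ Tᶜ = (qClosure ρ T)ᶜ := @interior_compl X (qTopology ρ) T
  rwa [h2] at h

lemma le_qSetDist_compl_qInterior (hA : 1 ≤ A₀) (hρ : IsQuasiMetric A₀ ρ) {S : Set X} {p : X}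
    {r : ℝ} (hr : 0 < r) (hS : qBall ρ p r ⊆ S) :
    ENNReal.ofReal (r / (2 * A₀)) ≤ qSetDist ρ p (qInterior ρ S)ᶜ := by
  refine le_iInf₂ fun y hy => ENNReal.ofReal_le_ofReal ?_
  by_contra! hlt
  refine hy ((mem_qInterior_iff hA hρ).2 ⟨r / (2 * A₀), by positivity, ?_⟩)
  rw [hρ.symm] at hlt
  refine (qBall_subset_qBall hA hρ hlt (le_of_eq ?_)).trans hS
  field_simp
  ring

lemma qBoundary_subset_boundaryZone (hρ : IsQuasiMetric A₀ ρ) (S : Set X) (ε : ℝ) :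
    qBoundary ρ S ⊆ boundaryZone ρ ε S := by
  rintro p ⟨h1, h2⟩
  refine ⟨h1, (iInf₂_le p h2).trans ?_⟩
  simp [(hρ.eq_zero_iff p p).2 rfl]

lemma IsGeometricallyDoubling.exists_finset_cover {A₁ : ℕ} (h : IsGeometricallyDoubling ρ A₁)
    (n : ℕ) (p : X) {r : ℝ} (hr : 0 < r) :
    ∃ s : Finset X, qBall ρ p r ⊆ ⋃ y ∈ s, qBall ρ y (r / 2 ^ n) := by
  classical
  induction n with
  | zero => exact ⟨{p}, by simp⟩
  | succ n ih =>
    obtain ⟨s, hs⟩ := ih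
    choose t _ ht using fun y => h y (r / 2 ^ n) (by positivity)
    refine ⟨s.biUnion t, fun w hw => ?_⟩
    obtain ⟨y, hy, hwy⟩ := mem_iUnion₂.1 (hs hw)
    obtain ⟨v, hv, hwv⟩ := mem_iUnion₂.1 (ht y hwy)
    refine mem_iUnion₂.2 ⟨v, Finset.mem_biUnion.2 ⟨y, hy, hv⟩, ?_⟩
    rwa [pow_succ, ← div_div]

/-- Iterated halving covers a bounded ball by finitely many balls too small to contain two of the
points. -/
lemma countable_of_separated (hA : 1 ≤ A₀) (hρ : IsQuasiMetric A₀ ρ) {A₁ : ℕ}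
    (hd : IsGeometricallyDoubling ρ A₁) {J : Type v} {f : J → X} {ε : ℝ} (hε : 0 < ε)
    (hf : ∀ i j, i ≠ j → ε ≤ ρ (f i) (f j)) : Countable J := by
  rcases isEmpty_or_nonempty J with hJ | ⟨⟨i₀⟩⟩
  · infer_instance
  have hfin : ∀ R : ℕ, {i | f i ∈ qBall ρ (f i₀) (R + 1)}.Finite := by
    intro R
    obtain ⟨n, hn⟩ := pow_unbounded_of_one_lt (2 * A₀ * (R + 1) / ε) one_lt_two
    obtain ⟨s, hs⟩ := hd.exists_finset_cover n (f i₀) (r := R + 1) (by positivity)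
    refine Set.Finite.subset (s.finite_toSet.biUnion
      (t := fun y => {i | f i ∈ qBall ρ y ((R + 1) / 2 ^ n)}) fun y _ => ?_) ?_
    · refine Set.Subsingleton.finite fun i hi j hj => ?_
      by_contra hij
      have h1 := hf i j hij
      have h2 := hρ.quasi_triangle (f i) (f j) y
      rw [hρ.symm y] at h2
      have hi' : ρ (f i) y < (R + 1) / 2 ^ n := hi
      have hj' : ρ (f j) y < (R + 1) / 2 ^ n := hj
      have h3 : A₀ * (ρ (f i) y + ρ (f j) y) < A₀ * ((R + 1) / 2 ^ n + (R + 1) / 2 ^ n) :=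
        mul_lt_mul_of_pos_left (add_lt_add hi' hj') (by linarith)
      have h4 : A₀ * (((R : ℝ) + 1) / 2 ^ n + (R + 1) / 2 ^ n) < ε := by
        rw [div_lt_iff₀ hε] at hn
        rw [← add_div, ← mul_div_assoc, div_lt_iff₀ (by positivity)]
        linarith
      linarith
    · intro i hi
      simpa using hs hi
  have huniv : (univ : Set J) = ⋃ R : ℕ, {i | f i ∈ qBall ρ (f i₀) (R + 1)} := by
    refine (eq_univ_of_forall fun i => ?_).symm
    obtain ⟨R, hR⟩ := exists_nat_gt (ρ (f i) (f i₀))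
    refine mem_iUnion.2 ⟨R, ?_⟩
    change ρ (f i) (f i₀) < R + 1
    linarith
  rw [← Set.countable_univ_iff, huniv]
  exact countable_iUnion fun R => (hfin R).countable

/-- A point with a ball inside a cube of some generation is away from the boundary zones of all
cubes of coarser generations. -/
lemma IsDyadicSystem.notMem_boundaryZone {I : ℤ → Type v} {c₀ C₀ δ : ℝ} {z : ∀ k, I k → X}
    {Q : ∀ k, I k → Set X} (hA : 1 ≤ A₀) (hρ : IsQuasiMetric A₀ ρ)
    (hQ : IsDyadicSystem A₀ c₀ C₀ ρ δ z Q) {k l : ℤ} (hkl : k ≤ l) {β : I l} {p : X} {r ε : ℝ}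
    (hr : 0 < r) (hp : qBall ρ p r ⊆ Q l β) (hε : ε < r / (2 * A₀)) (α : I k) :
    p ∉ boundaryZone ρ ε (Q k α) := by
  rintro ⟨h1, h2⟩
  rcases hQ.nested k l hkl α β with h | h
  · have h3 := (le_qSetDist_compl_qInterior hA hρ hr (hp.trans h)).trans h2
    exact absurd h3 (not_le.2 ((ENNReal.ofReal_lt_ofReal_iff (by positivity)).2 hε))
  · exact notMem_qClosure_of_disjoint hA hρ hr hp
      (Set.disjoint_iff_inter_eq_empty.2 (by rwa [inter_comm])) h1

end QuasiMetric

/-! ### Random centres and independence -/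

section RandomSystem

variable {X : Type u} {I : ℤ → Type v} {Ω : ℤ → Type w} [∀ k, MeasurableSpace (Ω k)]
  {A₀ : ℝ} {ρ : X → X → ℝ} {δ τ₀ : ℝ} {x : ∀ k, I k → X} {parent : ∀ k, I (k + 1) → I k}
  {P : Measure (∀ k, Ω k)} {z : ∀ k, I k → Ω k → X} {Q : ∀ k, I k → (∀ j, Ω j) → Set X}

/-- The pairs `(p, ω)` such that some reference point of generation `l + 1` close to `p` is
chosen as the centre of its parent. -/
def centredPairs (A₀ : ℝ) (ρ : X → X → ℝ) (δ : ℝ) (x : ∀ k, I k → X)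
    (parent : ∀ k, I (k + 1) → I k) (z : ∀ k, I k → Ω k → X) (l : ℤ) :
    Set (X × (∀ j, Ω j)) :=
  ⋃ β : I (l + 1), qInterior ρ (qBall ρ (x (l + 1) β) (2 * A₀ * δ ^ (l + 1))) ×ˢ
    {ω | z l (parent l β) (ω l) = x (l + 1) β}

lemma IsRandomDyadicSystem.measurableSet_centre_eq
    (h : IsRandomDyadicSystem A₀ ρ δ τ₀ x parent P z Q) (l : ℤ) (β : I (l + 1)) :
    MeasurableSet {ω : ∀ j, Ω j | z l (parent l β) (ω l) = x (l + 1) β} :=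
  measurable_pi_apply l (h.measurableSet_eq l _ β rfl)

/-- This is why `centredPairs` uses interiors: a ball itself may fail to be measurable. The radius
`2 * A₀ * δ ^ (l + 1)` leaves the ball of radius `δ ^ (l + 1)` inside the interior. -/
lemma IsRandomDyadicSystem.measurableSet_centredPairs [MeasurableSpace X]
    [∀ k, Countable (I k)] (hX : ∀ U : Set X, IsOpen[qTopology ρ] U → MeasurableSet U)
    (h : IsRandomDyadicSystem A₀ ρ δ τ₀ x parent P z Q) (l : ℤ) :
    MeasurableSet (centredPairs A₀ ρ δ x parent z l) :=
  MeasurableSet.iUnion fun β =>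
    (hX _ (isOpen_qInterior _)).prod (h.measurableSet_centre_eq l β)

lemma IsRandomDyadicSystem.exists_qBall_subset (hA : 1 ≤ A₀) (hδ₀ : 0 < δ)
    (hδ : 144 * A₀ ^ 8 * δ ≤ 1) (hρ : IsQuasiMetric A₀ ρ)
    (h : IsRandomDyadicSystem A₀ ρ δ τ₀ x parent P z Q) {l : ℤ} {p : X} {ω : ∀ j, Ω j}
    (hp : (p, ω) ∈ centredPairs A₀ ρ δ x parent z l) :
    ∃ α : I l, qBall ρ p (δ ^ (l + 1)) ⊆ Q l α ω := by
  obtain ⟨β, hβ, hz⟩ := mem_iUnion.1 hp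
  have hβ' := qInterior_subset _ hβ
  have hz' : z l (parent l β) (ω l) = x (l + 1) β := hz
  refine ⟨parent l β, ?_⟩
  refine (qBall_subset_qBall hA hρ hβ' ?_).trans
    (hz' ▸ (h.dyadic ω).ball_subset l (parent l β))
  have hpos : 0 < δ ^ l := zpow_pos hδ₀ l
  have hA0 : 0 < A₀ := by linarith
  -- After clearing denominators: `12 A₀⁵ δ + 24 A₀⁶ δ ≤ 36 A₀⁸ δ ≤ 1`.
  have hc : A₀ * (δ + 2 * A₀ * δ) ≤ (3 * A₀ ^ 2)⁻¹ * (4 * A₀ ^ 2)⁻¹ := by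
    rw [← mul_inv, ← one_div, le_div_iff₀ (by positivity)]
    have h1 : A₀ ^ 5 ≤ A₀ ^ 8 := pow_le_pow_right₀ hA (by norm_num)
    have h2 : A₀ ^ 6 ≤ A₀ ^ 8 := pow_le_pow_right₀ hA (by norm_num)
    have h3 := mul_le_mul_of_nonneg_right h1 hδ₀.le
    have h4 := mul_le_mul_of_nonneg_right h2 hδ₀.le
    have h5 : 0 < A₀ ^ 8 * δ := by positivity
    linear_combination 12 * h3 + 24 * h4 + hδ + 108 * h5
  rw [zpow_add_one₀ hδ₀.ne']
  calc _ = A₀ * (δ + 2 * A₀ * δ) * δ ^ l := by ring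
    _ ≤ _ := mul_le_mul_of_nonneg_right hc hpos.le

lemma IsRandomDyadicSystem.notMem_centredPairs (hA : 1 ≤ A₀) (hδ₀ : 0 < δ)
    (hδ : 144 * A₀ ^ 8 * δ ≤ 1) (hρ : IsQuasiMetric A₀ ρ)
    (h : IsRandomDyadicSystem A₀ ρ δ τ₀ x parent P z Q) {k l : ℤ} (hkl : k ≤ l) {p : X}
    {ω : ∀ j, Ω j} {ε : ℝ} (hε : ε < δ ^ (l + 1) / (2 * A₀))
    (hp : p ∈ ⋃ α : I k, boundaryZone ρ ε (Q k α ω)) :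
    (p, ω) ∉ centredPairs A₀ ρ δ x parent z l := by
  intro hg
  obtain ⟨α, hα⟩ := mem_iUnion.1 hp
  obtain ⟨β, hβ⟩ := h.exists_qBall_subset hA hδ₀ hδ hρ hg
  exact (h.dyadic ω).notMem_boundaryZone hA hρ hkl (zpow_pos hδ₀ _) hβ hε α hα

lemma IsRandomDyadicSystem.measure_forall_notMem_centredPairs_le [IsProbabilityMeasure P]
    (hA : 1 ≤ A₀) (hδ₀ : 0 < δ) (hρ : IsQuasiMetric A₀ ρ) (hx : IsReferencePoints ρ δ x)
    (h : IsRandomDyadicSystem A₀ ρ δ τ₀ x parent P z Q) (p : X) (k : ℤ) (n : ℕ) :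
    P {ω | ∀ l, k ≤ l → l < k + n → (p, ω) ∉ centredPairs A₀ ρ δ x parent z l} ≤
      (1 - ENNReal.ofReal τ₀) ^ n := by
  choose β hβ using fun l : ℤ => hx.covering (l + 1) p
  let B : ∀ l, Set (Ω l) := fun l => {s | z l (parent l (β l)) s = x (l + 1) (β l)}ᶜ
  have hB : ∀ l, MeasurableSet (B l) := fun l => (h.measurableSet_eq l _ (β l) rfl).compl
  have hsub : {ω | ∀ l, k ≤ l → l < k + n → (p, ω) ∉ centredPairs A₀ ρ δ x parent z l} ⊆
      ⋂ l ∈ Finset.Ico k (k + n), (fun ω : ∀ j, Ω j => ω l) ⁻¹' B l := by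
    refine fun ω hω => mem_iInter₂.2 fun l hl hz => ?_
    obtain ⟨h1, h2⟩ := Finset.mem_Ico.1 hl
    exact hω l h1 h2 (mem_iUnion.2
      ⟨β l, qBall_subset_qInterior_qBall hA hρ _ (zpow_pos hδ₀ _) (hβ l), hz⟩)
  refine (measure_mono hsub).trans ?_
  rw [h.indep.measure_inter_preimage_eq_mul _ (fun l _ => hB l)]
  have hcard : (Finset.Ico k (k + n)).card = n := by simp
  conv_rhs => rw [← hcard]
  refine Finset.prod_le_pow_card _ _ _ fun l _ => ?_
  change P {ω | z l (parent l (β l)) (ω l) = x (l + 1) (β l)}ᶜ ≤ _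
  rw [prob_compl_eq_one_sub (h.measurableSet_centre_eq l (β l))]
  exact tsub_le_tsub_left (h.le_prob l _ (β l) rfl) _

lemma IsRandomDyadicSystem.measure_iUnion_boundaryZone_le [IsProbabilityMeasure P]
    (hA : 1 ≤ A₀) (hδ₀ : 0 < δ) (hδ₁ : δ < 1) (hδ : 144 * A₀ ^ 8 * δ ≤ 1)
    (hρ : IsQuasiMetric A₀ ρ) (hx : IsReferencePoints ρ δ x)
    (h : IsRandomDyadicSystem A₀ ρ δ τ₀ x parent P z Q) (p : X) {τ : ℝ} (k : ℤ) (n : ℕ)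
    (hn : τ < δ ^ n / (2 * A₀)) :
    P {ω | p ∈ ⋃ α : I k, boundaryZone ρ (τ * δ ^ k) (Q k α ω)} ≤
      (1 - ENNReal.ofReal τ₀) ^ n := by
  refine (measure_mono fun ω hω => ?_).trans
    (h.measure_forall_notMem_centredPairs_le hA hδ₀ hρ hx p k n)
  intro l hkl hln
  refine h.notMem_centredPairs hA hδ₀ hδ hρ hkl ?_ hω
  -- The last generation is `l = k + n - 1`, so `l + 1 ≤ k + n`.
  have h1 : δ ^ n * δ ^ k ≤ δ ^ (l + 1) := by
    rw [← zpow_natCast, ← zpow_add₀ hδ₀.ne']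
    exact zpow_le_zpow_right_of_le_one₀ hδ₀ hδ₁.le (by omega)
  calc τ * δ ^ k < δ ^ n / (2 * A₀) * δ ^ k := mul_lt_mul_of_pos_right hn (zpow_pos hδ₀ k)
    _ = δ ^ n * δ ^ k / (2 * A₀) := by ring
    _ ≤ δ ^ (l + 1) / (2 * A₀) := by gcongr

end RandomSystem

/-! ### Power decay and the main theorem -/

/-- Geometric decay in the exponent of `δ` is power decay. -/
lemma exists_rpow_bound_of_pow_bound {δ K q : ℝ} (hδ₀ : 0 < δ) (hδ₁ : δ < 1) (hK : 0 < K)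
    (hq₀ : 0 < q) (hq₁ : q < 1) :
    ∃ C η : ℝ, 0 < C ∧ 0 < η ∧ ∀ τ : ℝ, 0 < τ →
      1 ≤ C * τ ^ η ∨ ∃ n : ℕ, τ ≤ δ ^ n / K ∧ q ^ n ≤ C * τ ^ η := by
  have hlδ := Real.log_neg hδ₀ hδ₁
  have hlq := Real.log_neg hq₀ hq₁
  -- The exponent is chosen so that `δ ^ η = q`; then `n` comes from `δ ^ (n + 1) < K * τ ≤ δ ^ n`,
  -- and the lost factor `δ` goes into the constant `(K / δ) ^ η`.
  have hη : 0 < Real.log q / Real.log δ := div_pos_of_neg_of_neg hlq hlδ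
  have hδη : δ ^ (Real.log q / Real.log δ) = q := by
    rw [Real.rpow_def_of_pos hδ₀, mul_div_cancel₀ _ hlδ.ne, Real.exp_log hq₀]
  refine ⟨(K / δ) ^ (Real.log q / Real.log δ), _, by positivity, hη, fun τ hτ => ?_⟩
  rw [← Real.mul_rpow (by positivity) hτ.le]
  rcases le_or_gt 1 (K * τ) with h1 | h1
  · left
    refine Real.one_le_rpow ?_ hη.le
    rw [div_mul_eq_mul_div, le_div_iff₀ hδ₀]
    linarith
  · right
    obtain ⟨n, hn1, hn2⟩ := exists_nat_pow_near_of_lt_one (by positivity : 0 < K * τ) h1.le hδ₀ hδ₁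
    refine ⟨n, (le_div_iff₀' hK).2 hn2, ?_⟩
    calc q ^ n = (δ ^ n) ^ (Real.log q / Real.log δ) := by
          rw [← hδη, ← Real.rpow_natCast, ← Real.rpow_natCast, ← Real.rpow_mul hδ₀.le,
            ← Real.rpow_mul hδ₀.le, mul_comm, hδη]
      _ ≤ (K / δ * τ) ^ (Real.log q / Real.log δ) := by
          refine Real.rpow_le_rpow (by positivity) ?_ hη.le
          rw [div_mul_eq_mul_div, le_div_iff₀ hδ₀, ← pow_succ]
          exact hn1.le

theorem theorem5p6 (A₀ δ τ₀ : ℝ) (hA₀ : 1 ≤ A₀) (hδ₀ : 0 < δ) (hδ₁ : δ < 1)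
    (hδ : 144 * A₀ ^ 8 * δ ≤ 1) (hτ₀ : 0 < τ₀) :
    ∃ C₂ η : ℝ, 0 < C₂ ∧ 0 < η ∧
      ∀ (X : Type u) (ρ : X → X → ℝ) (A₁ : ℕ) (I : ℤ → Type v)
        (x : ∀ k, I k → X) (parent : ∀ k, I (k + 1) → I k)
        (Ω : ℤ → Type w) [∀ k, MeasurableSpace (Ω k)]
        (P : Measure (∀ k, Ω k)) [IsProbabilityMeasure P]
        (z : ∀ k, I k → Ω k → X) (Q : ∀ k, I k → (∀ j, Ω j) → Set X),
        IsQuasiMetric A₀ ρ → IsGeometricallyDoubling ρ A₁ →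
        IsReferencePoints ρ δ x → IsParentMap A₀ ρ δ x parent →
        IsRandomDyadicSystem A₀ ρ δ τ₀ x parent P z Q →
        (∀ (p : X) (τ : ℝ) (k : ℤ), 0 < τ →
          P {ω | p ∈ ⋃ α : I k, boundaryZone ρ (τ * δ ^ k) (Q k α ω)}
            ≤ ENNReal.ofReal (C₂ * τ ^ η)) ∧
        (∀ p : X, P {ω | p ∈ ⋃ (k : ℤ) (α : I k), qBoundary ρ (Q k α ω)} = 0) ∧
        (∀ [MeasurableSpace X], (∀ U : Set X, IsOpen[qTopology ρ] U → MeasurableSet U) →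
          ∀ (μ : Measure X) [SigmaFinite μ],
            ∀ᵐ ω ∂P, μ (⋃ (k : ℤ) (α : I k), qBoundary ρ (Q k α ω)) = 0) := by
  -- `4 * A₀` in place of `2 * A₀` makes the required inequality strict; the `1 / 2` keeps `q`
  -- positive when `τ₀ ≥ 1`.
  obtain ⟨C₂, η, hC₂, hη, hbound⟩ := exists_rpow_bound_of_pow_bound (K := 4 * A₀)
    (q := max (1 - τ₀) (1 / 2)) hδ₀ hδ₁ (by positivity) (by positivity)
    (max_lt (by linarith) (by norm_num))
  have hq : 1 - ENNReal.ofReal τ₀ ≤ ENNReal.ofReal (max (1 - τ₀) (1 / 2)) := by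
    rw [← ENNReal.ofReal_one, ← ENNReal.ofReal_sub _ hτ₀.le]
    exact ENNReal.ofReal_le_ofReal (le_max_left _ _)
  refine ⟨C₂, η, hC₂, hη, ?_⟩
  intro X ρ A₁ I x parent Ω _ P _ z Q hρ hd hx _ h
  have hzone : ∀ (p : X) (τ : ℝ) (k : ℤ), 0 < τ →
      P {ω | p ∈ ⋃ α : I k, boundaryZone ρ (τ * δ ^ k) (Q k α ω)}
        ≤ ENNReal.ofReal (C₂ * τ ^ η) := by
    intro p τ k hτ
    rcases hbound τ hτ with h1 | ⟨n, hn, h1⟩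
    · exact prob_le_one.trans (ENNReal.one_le_ofReal.2 h1)
    · refine (h.measure_iUnion_boundaryZone_le hA₀ hδ₀ hδ₁ hδ hρ hx p k n
        (hn.trans_lt ?_)).trans ?_
      · have : 0 < δ ^ n := pow_pos hδ₀ n
        gcongr
        norm_num
      · refine (pow_le_pow_left' hq n).trans ?_
        rw [← ENNReal.ofReal_pow (by positivity)]
        exact ENNReal.ofReal_le_ofReal h1
  have hnull : ∀ (p : X) (k : ℤ),
      P {ω | ∀ l, k ≤ l → (p, ω) ∉ centredPairs A₀ ρ δ x parent z l} = 0 := by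
    intro p k
    have hlt : 1 - ENNReal.ofReal τ₀ < 1 :=
      ENNReal.sub_lt_self ENNReal.one_ne_top one_ne_zero (by simpa using hτ₀)
    refine le_antisymm (ge_of_tendsto' (ENNReal.tendsto_pow_atTop_nhds_zero_of_lt_one hlt)
      fun n => ?_) bot_le
    refine (measure_mono ?_).trans
      (h.measure_forall_notMem_centredPairs_le hA₀ hδ₀ hρ hx p k n)
    exact fun ω hω l hl _ => hω l hl
  have hsub : ∀ (p : X) (ω : ∀ j, Ω j) (k : ℤ), p ∈ ⋃ α : I k, qBoundary ρ (Q k α ω) →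
      ∀ l, k ≤ l → (p, ω) ∉ centredPairs A₀ ρ δ x parent z l := by
    intro p ω k hp l hl
    have : 0 < δ ^ (l + 1) := zpow_pos hδ₀ _
    exact h.notMem_centredPairs hA₀ hδ₀ hδ hρ hl (ε := 0) (by positivity)
      (iUnion_mono (fun α => qBoundary_subset_boundaryZone hρ _ _) hp)
  refine ⟨hzone, fun p => ?_, ?_⟩
  · have : {ω | p ∈ ⋃ (k : ℤ) (α : I k), qBoundary ρ (Q k α ω)} ⊆
        ⋃ k : ℤ, {ω | ∀ l, k ≤ l → (p, ω) ∉ centredPairs A₀ ρ δ x parent z l} := by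
      intro ω hω
      obtain ⟨k, hk⟩ := mem_iUnion.1 hω
      exact mem_iUnion.2 ⟨k, hsub p ω k hk⟩
    exact measure_mono_null this (measure_iUnion_null fun k => hnull p k)
  · intro _ hX μ _
    have hI : ∀ k, Countable (I k) := fun k =>
      countable_of_separated hA₀ hρ hd (zpow_pos hδ₀ k) (hx.separated k)
    -- The boundary pairs need not be measurable, but `N` is and contains them. Its slices at fixed
    -- `p` are null, hence so are almost all slices at fixed `ω`.
    let N : Set (X × (∀ j, Ω j)) :=
      ⋃ k : ℤ, ⋂ l : ℤ, ⋂ _ : k ≤ l, (centredPairs A₀ ρ δ x parent z l)ᶜ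
    have hN : MeasurableSet N := MeasurableSet.iUnion fun k => MeasurableSet.iInter fun l =>
      MeasurableSet.iInter fun _ => (h.measurableSet_centredPairs hX l).compl
    have hN0 : (μ.prod P) N = 0 := by
      refine (Measure.measure_prod_null hN).2 (ae_of_all _ fun p => ?_)
      refine measure_mono_null (t := ⋃ k : ℤ,
        {ω | ∀ l, k ≤ l → (p, ω) ∉ centredPairs A₀ ρ δ x parent z l}) ?_
        (measure_iUnion_null fun k => hnull p k)
      intro ω hω
      simpa [N] using hω
    have hswap : (P.prod μ) (Prod.swap ⁻¹' N) = 0 := by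
      rw [← Measure.map_apply measurable_swap hN, Measure.prod_swap, hN0]
    have hae := (Measure.measure_prod_null (measurable_swap hN)).1 hswap
    filter_upwards [hae] with ω hω
    refine measure_mono_null (fun p hp => ?_) hω
    obtain ⟨k, hk⟩ := mem_iUnion.1 hp
    have := hsub p ω k hk
    exact mem_iUnion.2 ⟨k, mem_iInter₂.2 this⟩
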